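/- Let $n\ge 1$. The fan graph $F_n$ has vertex set $\{0,1,\dots,n\}$ and edges $\{i,i+1\}$ for $1\le i<n$ and $\{0,i\}$ for $1\le i\le n$; the vertex $0$ is the sink. A configuration is a vector $c=(c_1,\dots,c_n)$ of non-negative integers; a vertex $i\in\{1,\dots,n\}$ is stable if $c_i<\deg(i)$, and $c$ is stable if all of $1,\dots,n$ are. When an unstable vertex topples, in the Abelian sandpile model (ASM) it sends one grain to each of its neighbours, and in the stochastic sandpile model (SSM) it sends one grain to each neighbour independently with probability $p$, where $p\in(0,1)$ is fixed; grains sent to the sink disappear. In either model, the Markov chain on stable configurations adds, at each step, a grain at a random vertex of $\{1,\dots,n\}$, drawn independently from a fixed distribution $\mu$ with $\mu_i>0$ for all $i$, and then topples unstable vertices until the configuration is stable. A stable configuration is recurrent if the chain started from it almost surely visits it infinitely often. On $F_n$ the two models have the same set of recurrent configurations, denoted $\mathrm{Rec}(F_n)$. The level of $c\in\mathrm{Rec}(F_n)$ is $\mathrm{level}(c)=\sum_{i=1}^n c_i+\deg(0)-|E(F_n)|=\sum_{i=1}^n c_i-(n-1)$. A properly-marked $\{L,R\}$-word is a word on the alphabet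 $\{L^u,L^m,R\}$ in which no $L^m$ is immediately followed by $R$; the letters $L^m$ are its marked elements. Let $\mathrm{PMW}_{m}$ be the set of such words of length $m$. For $c\in\mathrm{Rec}(F_n)$, direct the edges of the path $0-1-\cdots-n$ and mark some of its vertices, from left to right, as follows. (1) Direct the edge $\{0,1\}$ as $0\leftarrow 1$. (2) For $i=1,\dots,n-1$: if $i-1\leftarrow i$, then direct $i\to i+1$ if $c_i=0$, and otherwise direct $i\leftarrow i+1$ and mark $i$ if $c_i=2$; if $i-1\to i$, then direct $i\to i+1$ if $c_i=1$ and $i\leftarrow i+1$ if $c_i=2$ (no other value of $c_i$ occurs in this case). (3) Mark $n$ if $n-1\leftarrow n$ and $c_n=1$. Let $\Phi_F(c)$ be the word of length $n-1$ whose $j$-th letter ($1\le j\le n-1$) is $R$ if $j\to j+1$, is $L^m$ if $j\leftarrow j+1$ and $j+1$ is marked, and is $L^u$ if $j\leftarrow j+1$ and $j+1$ is not marked. Theorem. The map $\Phi_F:\mathrm{Rec}(F_n)\to\mathrm{PMW}_{n-1}$ is a bijection. Moreover, for every $c\in\mathrm{Rec}(F_n)$, $\mathrm{level}(c)$ is equal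 to the number of marked elements of the word $\Phi_F(c)$. -/

import Mathlib

open scoped unitInterval

/-! ## Sandpile models on a graph with vertices `0, 1, …, n`, where `0` is the sink -/

/-- A configuration: `c k` is the number of grains at the non-sink vertex `k.succ`,
so the vertices `1, …, n` correspond to `k = 0, …, n - 1`. -/
abbrev Config (n : ℕ) : Type := Fin n → ℕ

section Sandpile

variable {n : ℕ} (G : SimpleGraph (Fin (n + 1))) [DecidableRel G.Adj]

/-- The non-sink vertex `k.succ` is unstable: it has at least as many grains as neighbours. -/
abbrev IsUnstableAt (c : Config n) (k : Fin n) : Prop := G.degree k.succ ≤ c k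

/-- A configuration is stable if every non-sink vertex has fewer grains than its degree. -/
abbrev IsStable (c : Config n) : Prop := ∀ k : Fin n, c k < G.degree k.succ

/-- Vertex `k.succ` sends one grain to each vertex of `S`; grains sent to the sink disappear.
Only used when `S` is a set of neighbours of `k.succ` and `k.succ` is unstable, so the
subtraction does not truncate. -/
def sendGrains (c : Config n) (k : Fin n) (S : Finset (Fin (n + 1))) : Config n :=
  fun l => c l - (if l = k then S.card else 0) + (if l.succ ∈ S then 1 else 0)

/-- Adding one grain at the vertex `k.succ`. -/
def addGrain (c : Config n) (k : Fin n) : Config n := c + Pi.single k 1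

/-- The level of a configuration: `∑ c_i + deg 0 - |E|`. -/
def level (c : Config n) : ℤ :=
  (∑ k, (c k : ℤ)) + (G.degree 0 : ℤ) - (G.edgeFinset.card : ℤ)

/-! ### The Abelian sandpile model -/

/-- The toppling operator: `k.succ` sends one grain to each of its neighbours. -/
def topple (c : Config n) (k : Fin n) : Config n := sendGrains c k (G.neighborFinset k.succ)

/-- `d` is obtained from `c` by toppling one unstable vertex. -/
def ToppleStep (c d : Config n) : Prop := ∃ k, IsUnstableAt G c k ∧ d = topple G c k

/-- `d` is stable and is obtained from `c` by successively toppling unstable vertices. -/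
def StabilisesTo (c d : Config n) : Prop :=
  Relation.ReflTransGen (ToppleStep G) c d ∧ IsStable G d

open Classical in
/-- The stabilisation of `c`: the stable configuration reached from `c` by successively toppling
unstable vertices. (It exists and is unique when `G` is connected; the value where there is none
is irrelevant.) -/
noncomputable def stabilise (c : Config n) : Config n :=
  if h : ∃ d, StabilisesTo G c d then h.choose else c

/-- The run of the ASM Markov chain started at `c`, where the `t`-th grain is added at `ω t`. -/
noncomputable def asmRun (c : Config n) (ω : ℕ → Fin n) : ℕ → Config n
  | 0 => c
  | t + 1 => stabilise G (addGrain (asmRun c ω t) (ω t))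

/-- The recurrent configurations of the ASM, for the grain distribution `μ`: the recurrent states
of the Markov chain on stable configurations, that is, those which the chain started from them
almost surely visits infinitely often. The grains are added at independent vertices of law `μ`. -/
def ASMRec (μ : PMF (Fin n)) : Set (Config n) :=
  {c | IsStable G c ∧
    ∀ᵐ ω ∂(MeasureTheory.Measure.infinitePi fun _ : ℕ => μ.toMeasure),
      ∃ᶠ t in Filter.atTop, asmRun G c ω t = c}

/-! ### The stochastic sandpile model -/

/-- The random toppling of `k.succ` when the coin flips are `b`: one grain is sent to each
neighbour whose coin shows `true`. -/
def coinTopple (c : Config n) (k : Fin n) (b : Fin (n + 1) → Bool) : Config n :=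
  sendGrains c k {v ∈ G.neighborFinset k.succ | b v = true}

/-- One elementary operation of the SSM. If the configuration is stable, a grain is added at the
vertex `x.1`; otherwise its first unstable vertex topples with the coin flips `x.2`. -/
def ssmStep (c : Config n) (x : Fin n × (Fin (n + 1) → Bool)) : Config n :=
  match Fin.find? (fun k => decide (IsUnstableAt G c k)) with
  | none => addGrain c x.1
  | some k => coinTopple G c k x.2

/-- The run of the SSM started at `c`, recorded after each elementary operation. The Markov chain
on stable configurations consists of the successive stable configurations of this run. -/
def ssmRun (c : Config n) (ω : ℕ → Fin n × (Fin (n + 1) → Bool)) : ℕ → Config n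
  | 0 => c
  | t + 1 => ssmStep G (ssmRun c ω t) (ω t)

/-- The law of the randomness used by one elementary operation: a vertex of law `μ` and,
independently, independent coins showing `true` with probability `p`. -/
noncomputable def ssmNoise (μ : PMF (Fin n)) (p : I) :
    MeasureTheory.Measure (Fin n × (Fin (n + 1) → Bool)) :=
  μ.toMeasure.prod
    (MeasureTheory.Measure.pi fun _ => ProbabilityTheory.bernoulliMeasure true false p)

instance (μ : PMF (Fin n)) (p : I) : MeasureTheory.IsProbabilityMeasure (ssmNoise μ p) := by
  unfold ssmNoise; infer_instance

/-- The recurrent configurations of the SSM: the stable configurations which the model started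
from them almost surely visits infinitely often. -/
def SSMRec (μ : PMF (Fin n)) (p : I) : Set (Config n) :=
  {c | IsStable G c ∧
    ∀ᵐ ω ∂(MeasureTheory.Measure.infinitePi fun _ : ℕ => ssmNoise μ p),
      ∃ᶠ t in Filter.atTop, ssmRun G c ω t = c}

end Sandpile

/-! ## Fan graphs -/

/-- The fan graph: the join of the path `1 - 2 - ⋯ - n` and of the isolated vertex `0`. -/
def fanGraph (n : ℕ) : SimpleGraph (Fin (n + 1)) where
  Adj a b := a ≠ b ∧ (a = 0 ∨ b = 0 ∨ a.val + 1 = b.val ∨ b.val + 1 = a.val)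
  symm := ⟨fun _ _ h => ⟨h.1.symm, by tauto⟩⟩
  loopless := ⟨fun _ h => h.1 rfl⟩

instance (n : ℕ) : DecidableRel (fanGraph n).Adj := fun a b =>
  inferInstanceAs (Decidable (a ≠ b ∧ (a = 0 ∨ b = 0 ∨ a.val + 1 = b.val ∨ b.val + 1 = a.val)))

/-! ## Properly-marked words -/

/-- The letters `Lᵘ` (unmarked `L`), `Lᵐ` (marked `L`) and `R`. -/
inductive Letter : Type
  | Lu
  | Lm
  | R
  deriving DecidableEq

/-- The properly-marked words `w = w_0 ⋯ w_{m-1}` of length `m`: no `Lᵐ` is immediately followed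
by an `R`. -/
def PMW (m : ℕ) : Set (Fin m → Letter) :=
  {w | ∀ i j : Fin m, i.val + 1 = j.val → w i = Letter.Lm → w j ≠ Letter.R}

/-- The number of marked elements of a word. -/
def markedCount {m : ℕ} (w : Fin m → Letter) : ℕ :=
  (Finset.univ.filter fun i => w i = Letter.Lm).card

/-! ## The left-to-right construction -/

section Construction

variable {n : ℕ}

/-- The number of grains at the vertex `i ∈ {1, …, n}`. -/
def grains (c : Config n) (i : ℕ) : ℕ :=
  if h : 1 ≤ i ∧ i ≤ n then c ⟨i - 1, by omega⟩ else 0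

/-- Whether the edge `{i, i + 1}` of the path `0 - 1 - ⋯ - n` is directed rightwards,
`i → i + 1` (value `true`), or leftwards, `i ← i + 1` (value `false`). In the last line the
previous edge is directed rightwards and `c_{i+1}` is `1` (then rightwards) or `2` (then
leftwards). -/
def goesRight (c : Config n) : ℕ → Bool
  | 0 => false
  | i + 1 =>
    match goesRight c i with
    | false => decide (grains c (i + 1) = 0)
    | true => decide (grains c (i + 1) ≠ 2)

/-- Whether the vertex `i ∈ {1, …, n}` is marked: the edge `{i - 1, i}` is directed leftwards and
`c_i = 2` (if `i < n`), resp. `c_i = 1` (if `i = n`). Since `1` and `n` have degree `2` for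
`2 ≤ n`, a stable configuration has no more than `1` grain there. -/
abbrev IsMarked (c : Config n) (i : ℕ) : Prop :=
  goesRight c (i - 1) = false ∧ ((i < n ∧ grains c i = 2) ∨ (i = n ∧ grains c i = 1))

/-- The word of length `n - 1` obtained from the marked orientation: its letters correspond to
the edges `{1, 2}, …, {n - 1, n}`, each edge carrying the mark of its right endpoint. -/
def fanWord (c : Config n) : Fin (n - 1) → Letter := fun k =>
  if goesRight c (k.val + 1) = true then Letter.R
  else if IsMarked c (k.val + 2) then Letter.Lm
  else Letter.Lu

end Construction

/-! Both recurrent sets equal the set of stable configurations that dominate the indegrees of some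
orientation of the graph without its sink (`Orientable`). This property survives adding a grain and
any full or partial toppling, so it defines an invariant set. The largest stable configuration lies
in it and is reachable from everywhere, so recurrent configurations are orientable
(`mem_of_ae_frequently_visits`).

Conversely, every orientation of a path comes from a height function (`PathOriented.burnable`).
Dhar's burning argument then shows that `c + 1` topples back to `c` (`Burnable.reflTransGen`), so a
stable orientable `c` is reachable from every stable state (`Burnable.reachable`). By Borel–Cantelli
it is visited infinitely often (`ae_frequently_visits`). In the SSM, coins that all show `true`
imitate the ASM.

On the fan, the left-to-right construction points right only when forced, so it finds a valid
orientation as soon as one exists (`orientable_iff_leftFed`). Each `c_i` is then the indegree of `i`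
on the path plus one if `i` is marked (`LeftFed.grains_eq`). Hence the word determines `c`, and
summing over the `n - 1` path edges gives the level. The same formula turns any properly-marked word
into a configuration (`exists_fanWord_eq`). -/

/-! ## Recurrence of finite chains driven by independent noise -/

section DrivenChain

open MeasureTheory Filter

variable {S X : Type*}

/-- The run from `s` of the chain with update rule `f`, driven by the noise `ω`. -/
def drivenRun (f : S → X → S) (s : S) (ω : ℕ → X) : ℕ → S
  | 0 => s
  | t + 1 => f (drivenRun f s ω t) (ω t)

theorem drivenRun_mem {f : S → X → S} {K : Set S} (hK : ∀ s ∈ K, ∀ x, f s x ∈ K) {s : S}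
    {ω : ℕ → X} {t : ℕ} (ht : drivenRun f s ω t ∈ K) {t' : ℕ} (htt' : t ≤ t') :
    drivenRun f s ω t' ∈ K := by
  induction t', htt' using Nat.le_induction with
  | base => exact ht
  | succ m _ ih => exact hK _ ih _

theorem drivenRun_add_eq_foldl (f : S → X → S) (s : S) (ω : ℕ → X) (t : ℕ) (w : List X)
    (hw : ∀ i (hi : i < w.length), ω (t + i) = w[i]) :
    drivenRun f s ω (t + w.length) = w.foldl f (drivenRun f s ω t) := by
  induction w generalizing t with
  | nil => rfl
  | cons x w ih =>
    have h0 : ω t = x := hw 0 (by simp)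
    have := ih (t + 1) fun i hi => by
      rw [add_assoc, add_comm 1 i]
      exact hw (i + 1) (by simpa using hi)
    rw [List.length_cons, List.foldl_cons, ← h0, add_comm w.length, ← add_assoc, this]
    rfl

/-- `d` can be reached from `c` in finitely many updates. -/
def DrivenReach (f : S → X → S) : S → S → Prop :=
  Relation.ReflTransGen fun c d => ∃ x, d = f c x

theorem DrivenReach.exists_foldl {f : S → X → S} {c d : S} (h : DrivenReach f c d) :
    ∃ w : List X, w.foldl f c = d := by
  induction h with
  | refl => exact ⟨[], rfl⟩
  | tail _ hx ih =>
    obtain ⟨w, rfl⟩ := ih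
    obtain ⟨x, rfl⟩ := hx
    exact ⟨w ++ [x], by simp⟩

theorem foldl_mem {f : S → X → S} {K : Set S} (hK : ∀ s ∈ K, ∀ x, f s x ∈ K) (w : List X) {s : S}
    (hs : s ∈ K) : w.foldl f s ∈ K := by
  induction w generalizing s with
  | nil => exact hs
  | cons x w ih => exact ih (hK _ hs x)

/-- There is a word leading through `c` from every state of a finite invariant set. -/
theorem exists_universal_word {f : S → X → S} {K : Set S} (hfin : K.Finite)
    (hK : ∀ s ∈ K, ∀ x, f s x ∈ K) {c : S} (hc : ∀ s ∈ K, DrivenReach f s c) :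
    ∃ w : List X, ∀ s ∈ K, ∃ u v, w = u ++ v ∧ u.foldl f s = c := by
  suffices H : ∀ A : Set S, A.Finite → A ⊆ K →
      ∃ w : List X, ∀ s ∈ A, ∃ u v, w = u ++ v ∧ u.foldl f s = c from H K hfin subset_rfl
  intro A hA
  induction A, hA using Set.Finite.induction_on with
  | empty => exact fun _ => ⟨[], by simp⟩
  | @insert a A _ _ ih =>
    intro hAK
    obtain ⟨w, hw⟩ := ih ((Set.subset_insert _ _).trans hAK)
    -- Run `w` from the new state `a`, then append a word leading from where it ends to `c`;
    -- prefixes that work for the other states remain prefixes.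
    obtain ⟨w', hw'⟩ := (hc _ (foldl_mem hK w (hAK (Set.mem_insert _ _)))).exists_foldl
    refine ⟨w ++ w', fun s hs => ?_⟩
    rcases hs with rfl | hs
    · exact ⟨w ++ w', [], by simp, by simpa using hw'⟩
    · obtain ⟨u, v, rfl, hu⟩ := hw s hs
      exact ⟨u, v ++ w', by simp, hu⟩

variable [MeasurableSpace X] [MeasurableSingletonClass X]

/-- A word of letters of positive probability almost surely occurs infinitely often in a sequence
of independent letters. -/
theorem ae_frequently_occurs (ν : Measure X) [IsProbabilityMeasure ν] (w : List X)
    (hν : ∀ x ∈ w, ν {x} ≠ 0) :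
    ∀ᵐ ω ∂(Measure.infinitePi fun _ : ℕ => ν),
      ∃ᶠ m in atTop, ∀ i (hi : i < w.length), ω (m * w.length + i) = w[i] := by
  rcases Nat.eq_zero_or_pos w.length with h0 | hpos
  · exact .of_forall fun ω => .of_forall fun m i hi => by omega
  set N := w.length with hN
  let P := Measure.infinitePi fun _ : ℕ => ν
  -- Time is cut into disjoint blocks of length `N`; `A m` is the event that block `m` spells `w`.
  -- These events are independent with equal positive probability, so the second Borel–Cantelli
  -- lemma applies.
  let t : ℕ → Set X := fun j => {w[j % N]'(Nat.mod_lt _ hpos)}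
  let B : ℕ → Finset ℕ := fun m => Finset.Ico (m * N) (m * N + N)
  let A : ℕ → Set (ℕ → X) := fun m => Set.pi (B m) t
  have ht : ∀ j, MeasurableSet (t j) := fun j => measurableSet_singleton _
  have hA : ∀ m, MeasurableSet (A m) := fun m =>
    MeasurableSet.pi (B m).countable_toSet fun j _ => ht j
  have hB : Pairwise fun m m' => Disjoint (B m) (B m') := by
    intro m m' hmm'
    rw [Finset.disjoint_left]
    intro j hj hj'
    simp only [B, Finset.mem_Ico] at hj hj'
    rcases Nat.lt_or_gt_of_ne hmm' with h | h
    · have := Nat.mul_le_mul_right N (Nat.succ_le_of_lt h)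
      rw [Nat.succ_mul] at this
      omega
    · have := Nat.mul_le_mul_right N (Nat.succ_le_of_lt h)
      rw [Nat.succ_mul] at this
      omega
  have hPA : ∀ m, P (A m) = ∏ j ∈ B m, ν (t j) := fun m =>
    Measure.infinitePi_pi (fun _ => ν) fun j _ => ht j
  have hconst : ∀ m, P (A m) = ∏ i ∈ Finset.range N, ν (t i) := by
    intro m
    rw [hPA, Finset.prod_Ico_eq_prod_range]
    simp only [add_tsub_cancel_left]
    refine Finset.prod_congr rfl fun i _ => ?_
    simp only [t, Nat.mul_add_mod_self_right]
  have hindep : ProbabilityTheory.iIndepSet A P := by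
    rw [ProbabilityTheory.iIndepSet_iff_meas_biInter hA]
    intro s
    have : ⋂ m ∈ s, A m = Set.pi (s.biUnion B) t := by
      ext ω
      simp only [A, Set.mem_iInter, Set.mem_pi, Finset.mem_coe, Finset.mem_biUnion]
      exact ⟨fun h j ⟨m, hm, hj⟩ => h m hm j hj, fun h m hm j hj => h j ⟨m, hm, hj⟩⟩
    rw [this]
    simp only [hPA]
    rw [Measure.infinitePi_pi (fun _ => ν) fun j _ => ht j,
      Finset.prod_biUnion fun m _ m' _ h => hB h]
  have hsum : ∑' m, P (A m) = ⊤ := by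
    simp only [hconst]
    refine ENNReal.tsum_const_eq_top_of_ne_zero ?_
    exact Finset.prod_ne_zero_iff.mpr fun i _ => hν _ (List.getElem_mem _)
  have h1 := ProbabilityTheory.measure_limsup_eq_one hA hindep hsum
  have h2 : ∀ᵐ ω ∂P, ω ∈ limsup A atTop :=
    (prob_compl_eq_zero_iff (MeasurableSet.measurableSet_limsup hA)).mpr h1
  filter_upwards [h2] with ω hω
  rw [mem_limsup_iff_frequently_mem] at hω
  refine hω.mono fun m hm i hi => ?_
  have := hm (m * N + i) (by simp [B]; omega)
  have hmod : (m * N + i) % N = i := by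
    rw [Nat.mul_add_mod_self_right]
    exact Nat.mod_eq_of_lt hi
  simp only [t, Set.mem_singleton_iff, hmod] at this
  exact this

/-- A chain on a finite set driven by independent noise of full support almost surely visits
infinitely often any state that is reachable from everywhere. -/
theorem ae_frequently_visits (ν : Measure X) [IsProbabilityMeasure ν] (hν : ∀ x, ν {x} ≠ 0)
    {f : S → X → S} {K : Set S} (hfin : K.Finite) (hK : ∀ s ∈ K, ∀ x, f s x ∈ K)
    {c : S} (hc : ∀ s ∈ K, DrivenReach f s c) {s : S} (hs : s ∈ K) :
    ∀ᵐ ω ∂(Measure.infinitePi fun _ : ℕ => ν), ∃ᶠ t in atTop, drivenRun f s ω t = c := by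
  obtain ⟨w₀, hw₀⟩ := exists_universal_word hfin hK hc
  obtain ⟨x⟩ : Nonempty X := ν.nonempty_of_neZero
  -- The extra letter makes the word nonempty, so that block `m` starts no earlier than time `m`.
  have hw : ∀ s ∈ K, ∃ u v, w₀ ++ [x] = u ++ v ∧ u.foldl f s = c := fun s hs => by
    obtain ⟨u, v, rfl, hu⟩ := hw₀ s hs
    exact ⟨u, v ++ [x], by simp, hu⟩
  have hpos : 0 < (w₀ ++ [x]).length := by simp
  generalize w₀ ++ [x] = w at hw hpos
  filter_upwards [ae_frequently_occurs ν w fun x _ => hν x] with ω hω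
  rw [frequently_atTop] at hω ⊢
  intro a
  obtain ⟨m, hm, hmw⟩ := hω a
  obtain ⟨u, v, rfl, hu⟩ := hw _ (drivenRun_mem hK (ω := ω) (t := 0) hs
    (Nat.zero_le (m * w.length)))
  refine ⟨m * (u ++ v).length + u.length,
    le_trans hm ((Nat.le_mul_of_pos_right m hpos).trans (Nat.le_add_right _ _)), ?_⟩
  rw [drivenRun_add_eq_foldl, hu]
  intro i hi
  rw [hmw i (by simp; omega), List.getElem_append_left hi]

/-- A state visited infinitely often belongs to any invariant set containing some state that is
reachable from everywhere. -/
theorem mem_of_ae_frequently_visits (ν : Measure X) [IsProbabilityMeasure ν]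
    (hν : ∀ x, ν {x} ≠ 0) {f : S → X → S} {K : Set S} (hfin : K.Finite)
    (hK : ∀ s ∈ K, ∀ x, f s x ∈ K) {c₀ : S} (hc₀ : ∀ s ∈ K, DrivenReach f s c₀) {A : Set S}
    (hA : ∀ s ∈ A, ∀ x, f s x ∈ A) (hc₀A : c₀ ∈ A) {c : S} (hcK : c ∈ K)
    (hc : ∀ᵐ ω ∂(Measure.infinitePi fun _ : ℕ => ν), ∃ᶠ t in atTop, drivenRun f c ω t = c) :
    c ∈ A := by
  -- On a single sample path, the run meets `c₀`, stays in `A` from then on, and later returns to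
  -- `c`.
  obtain ⟨ω, h₀, h⟩ := ((ae_frequently_visits ν hν hfin hK hc₀ hcK).and hc).exists
  obtain ⟨t, ht⟩ := h₀.exists
  obtain ⟨t', htt', ht'⟩ := frequently_atTop.mp h t
  have := drivenRun_mem hA (ht.symm ▸ hc₀A) htt'
  rwa [ht'] at this

end DrivenChain

/-! ## Toppling on a graph all of whose vertices are adjacent to the sink -/

section Toppling

variable {n : ℕ} {G : SimpleGraph (Fin (n + 1))} [DecidableRel G.Adj]

/-! ### Abelian property and termination of topplings -/

theorem sendGrains_apply_add {c : Config n} {k : Fin n} {S : Finset (Fin (n + 1))}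
    (hS : S.card ≤ c k) (l : Fin n) :
    sendGrains c k S l + (if l = k then S.card else 0) = c l + if l.succ ∈ S then 1 else 0 := by
  unfold sendGrains
  by_cases h : l = k
  · subst h
    simp only [if_true]
    omega
  · simp [h]

theorem topple_apply_add {c : Config n} {k : Fin n} (h : IsUnstableAt G c k) (l : Fin n) :
    topple G c k l + (if l = k then G.degree k.succ else 0) =
      c l + if G.Adj k.succ l.succ then 1 else 0 := by
  simpa [topple] using sendGrains_apply_add (S := G.neighborFinset k.succ) (by simpa using h) l

theorem topple_add {c : Config n} {k : Fin n} (h : IsUnstableAt G c k) (e : Config n) :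
    topple G (c + e) k = topple G c k + e := by
  funext l
  have h1 := topple_apply_add h l
  have h2 := topple_apply_add (c := c + e) (k := k) (h.trans (Nat.le_add_right _ _)) l
  simp only [Pi.add_apply] at h2 ⊢
  omega

theorem ToppleStep.add {c d : Config n} (h : ToppleStep G c d) (e : Config n) :
    ToppleStep G (c + e) (d + e) := by
  obtain ⟨k, hk, rfl⟩ := h
  exact ⟨k, hk.trans (Nat.le_add_right _ _), (topple_add hk e).symm⟩

theorem reflTransGen_toppleStep_add {c d : Config n}
    (h : Relation.ReflTransGen (ToppleStep G) c d) (e : Config n) :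
    Relation.ReflTransGen (ToppleStep G) (c + e) (d + e) :=
  h.lift (· + e) fun _ _ h => h.add e

theorem isUnstableAt_topple {c : Config n} {k l : Fin n} (hk : IsUnstableAt G c k)
    (hl : IsUnstableAt G c l) (hkl : k ≠ l) : IsUnstableAt G (topple G c k) l := by
  have := topple_apply_add hk l
  simp only [hkl.symm, if_false] at this
  unfold IsUnstableAt at *
  omega

theorem topple_comm {c : Config n} {k l : Fin n} (hk : IsUnstableAt G c k)
    (hl : IsUnstableAt G c l) (hkl : k ≠ l) :
    topple G (topple G c k) l = topple G (topple G c l) k := by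
  funext i
  have h1 := topple_apply_add hk i
  have h2 := topple_apply_add hl i
  have h3 := topple_apply_add (isUnstableAt_topple hk hl hkl) i
  have h4 := topple_apply_add (isUnstableAt_topple hl hk hkl.symm) i
  omega

/-- Topplings of two distinct unstable vertices commute, and neither makes the other stable; this
diamond property yields confluence. -/
theorem join_toppleStep {c d e : Config n} (hd : Relation.ReflTransGen (ToppleStep G) c d)
    (he : Relation.ReflTransGen (ToppleStep G) c e) :
    Relation.Join (Relation.ReflTransGen (ToppleStep G)) d e := by
  refine Relation.church_rosser ?_ hd he
  rintro a b c ⟨k, hk, rfl⟩ ⟨l, hl, rfl⟩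
  by_cases hkl : k = l
  · subst hkl
    exact ⟨_, .refl, .refl⟩
  · exact ⟨topple G (topple G a k) l, .single ⟨l, isUnstableAt_topple hk hl hkl, rfl⟩,
      .single ⟨k, isUnstableAt_topple hl hk (Ne.symm hkl), topple_comm hk hl hkl⟩⟩

theorem IsStable.eq_of_reflTransGen {c d : Config n} (hc : IsStable G c)
    (h : Relation.ReflTransGen (ToppleStep G) c d) : d = c := by
  rcases h.cases_head with h | ⟨_, ⟨k, hk, _⟩, _⟩
  · exact h.symm
  · exact absurd (hc k) hk.not_gt

theorem StabilisesTo.of_reflTransGen {c d e : Config n} (he : StabilisesTo G c e)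
    (hd : Relation.ReflTransGen (ToppleStep G) c d) : StabilisesTo G d e := by
  obtain ⟨x, hdx, hex⟩ := join_toppleStep hd he.1
  exact ⟨he.2.eq_of_reflTransGen hex ▸ hdx, he.2⟩

theorem sum_sendGrains_add {c : Config n} {k : Fin n} {S : Finset (Fin (n + 1))}
    (hS : S.card ≤ c k) :
    ∑ l, sendGrains c k S l + S.card =
      ∑ l, c l + (Finset.univ.filter fun l : Fin n => l.succ ∈ S).card := by
  have := Finset.sum_congr (rfl : (Finset.univ : Finset (Fin n)) = Finset.univ)
    fun l _ => sendGrains_apply_add hS l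
  rw [Finset.sum_add_distrib, Finset.sum_add_distrib, Finset.sum_ite_eq',
    if_pos (Finset.mem_univ k)] at this
  rw [this, Finset.card_filter]

theorem card_filter_succ_mem (S : Finset (Fin (n + 1))) :
    (Finset.univ.filter fun l : Fin n => l.succ ∈ S).card + (if 0 ∈ S then 1 else 0) = S.card := by
  conv_rhs => rw [← Finset.filter_univ_mem S, Finset.card_filter, Fin.sum_univ_succ]
  rw [Finset.card_filter, add_comm]

theorem sum_sendGrains_le {c : Config n} {k : Fin n} {S : Finset (Fin (n + 1))}
    (hS : S.card ≤ c k) : ∑ l, sendGrains c k S l ≤ ∑ l, c l := by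
  have h1 := sum_sendGrains_add hS
  have h2 := card_filter_succ_mem S
  omega

theorem sum_topple_lt (hG : ∀ k : Fin n, G.Adj k.succ 0) {c : Config n} {k : Fin n}
    (h : IsUnstableAt G c k) : ∑ l, topple G c k l < ∑ l, c l := by
  have h1 := sum_sendGrains_add (c := c) (k := k) (S := G.neighborFinset k.succ) (by simpa using h)
  have h2 := card_filter_succ_mem (G.neighborFinset k.succ)
  rw [if_pos (by simpa using hG k)] at h2
  unfold topple
  omega

/-- Every toppling loses a grain to the adjacent sink, so the total number of grains strictly
decreases. -/
theorem exists_stabilisesTo (hG : ∀ k : Fin n, G.Adj k.succ 0) (c : Config n) :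
    ∃ d, StabilisesTo G c d := by
  induction hm : ∑ l, c l using Nat.strong_induction_on generalizing c with
  | _ m ih =>
    by_cases hc : IsStable G c
    · exact ⟨c, .refl, hc⟩
    · obtain ⟨k, hk⟩ : ∃ k, IsUnstableAt G c k := by simpa [IsStable] using hc
      obtain ⟨d, hd, hds⟩ := ih _ (hm ▸ sum_topple_lt hG hk) _ rfl
      exact ⟨d, .head ⟨k, hk, rfl⟩ hd, hds⟩

theorem stabilisesTo_stabilise (hG : ∀ k : Fin n, G.Adj k.succ 0) (c : Config n) :
    StabilisesTo G c (stabilise G c) := by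
  have h := exists_stabilisesTo hG c
  rw [stabilise, dif_pos h]
  exact h.choose_spec

/-! ### Orientations -/

/-- The edges between non-sink vertices can be oriented in such a way that every vertex has at
least as many grains as incoming edges (`o a b` means that the edge `{a, b}` points to `b`). -/
def Orientable (G : SimpleGraph (Fin (n + 1))) [DecidableRel G.Adj] (c : Config n) : Prop :=
  ∃ o : Fin n → Fin n → Bool, (∀ a b, G.Adj a.succ b.succ → o a b = true ∨ o b a = true) ∧
    ∀ k, (Finset.univ.filter fun l => G.Adj k.succ l.succ ∧ o l k = true).card ≤ c k

theorem Orientable.mono {c d : Config n} (h : Orientable G c) (hcd : c ≤ d) : Orientable G d :=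
  let ⟨o, ho, hc⟩ := h
  ⟨o, ho, fun k => (hc k).trans (hcd k)⟩

theorem Orientable.addGrain {c : Config n} (h : Orientable G c) (k : Fin n) :
    Orientable G (addGrain c k) :=
  h.mono fun _ => Nat.le_add_right _ _

/-- Reversing the edges along which grains travel and orienting the other edges towards the
toppled vertex preserves orientability. -/
theorem Orientable.sendGrains {c : Config n} (h : Orientable G c) {k : Fin n}
    (hk : IsUnstableAt G c k) {S : Finset (Fin (n + 1))} (hS : S ⊆ G.neighborFinset k.succ) :
    Orientable G (sendGrains c k S) := by
  obtain ⟨o, ho, hc⟩ := h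
  have hcard : S.card ≤ c k :=
    (Finset.card_le_card hS).trans (by simpa [G.card_neighborFinset_eq_degree] using hk)
  -- Edges at `k` point away from `k` exactly when they carry a grain; all other edges keep their
  -- orientation.
  refine ⟨fun a b => if a = k then decide (b.succ ∈ S) else if b = k then decide (a.succ ∉ S)
    else o a b, fun a b hab => ?_, fun l => ?_⟩
  · have hne : a ≠ b := by rintro rfl; exact hab.ne rfl
    by_cases ha : a = k
    · subst ha
      simp [hne.symm, em]
    · by_cases hb : b = k
      · subst hb
        simp [ha, em']
      · simpa [ha, hb] using ho a b hab
  · have hl := sendGrains_apply_add hcard l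
    by_cases hlk : l = k
    · subst hlk
      simp only [if_true] at hl
      -- At the toppled vertex, incoming edges come from neighbours outside `S`: at most `deg - |S|`
      -- of them, and at least that many grains remain.
      have hsub : (Finset.univ.filter fun j : Fin n => G.Adj l.succ j.succ ∧
          (if j = l then decide (l.succ ∈ S) else if l = l then decide (j.succ ∉ S) else o j l)
            = true) ⊆ Finset.univ.filter fun j : Fin n => j.succ ∈ G.neighborFinset l.succ \ S := by
        intro j
        simp only [Finset.mem_filter, Finset.mem_univ, true_and, Finset.mem_sdiff,
          SimpleGraph.mem_neighborFinset]
        rintro ⟨hj, hj'⟩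
        have : j ≠ l := by rintro rfl; exact hj.ne rfl
        exact ⟨hj, by simpa [this] using hj'⟩
      have h1 := Finset.card_le_card hsub
      have h2 := card_filter_succ_mem (G.neighborFinset l.succ \ S)
      have h3 := Finset.card_sdiff_of_subset hS
      have h4 := Finset.card_le_card hS
      rw [G.card_neighborFinset_eq_degree] at h3 h4
      unfold IsUnstableAt at hk
      refine h1.trans ?_
      omega
    · simp only [hlk, if_false, add_zero] at hl
      rw [hl]
      -- Elsewhere the only possible new incoming edge is the one from `k`, and it is paid for by
      -- the grain received.
      have hsub : (Finset.univ.filter fun j : Fin n => G.Adj l.succ j.succ ∧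
          (if j = k then decide (l.succ ∈ S) else if l = k then decide (j.succ ∉ S) else o j l)
            = true) ⊆
          (Finset.univ.filter fun j : Fin n => G.Adj l.succ j.succ ∧ o j l = true) ∪
            if l.succ ∈ S then {k} else ∅ := by
        intro j
        simp only [Finset.mem_filter, Finset.mem_univ, true_and, Finset.mem_union, hlk, if_false]
        rintro ⟨hj, hj'⟩
        by_cases hjk : j = k
        · subst hjk
          have : l.succ ∈ S := by simpa using hj'
          simp [this]
        · exact .inl ⟨hj, by simpa [hjk] using hj'⟩
      refine (Finset.card_le_card hsub).trans ((Finset.card_union_le _ _).trans ?_)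
      refine Nat.add_le_add (hc l) ?_
      split_ifs <;> simp

theorem Orientable.of_reflTransGen {c d : Config n} (h : Orientable G c)
    (hd : Relation.ReflTransGen (ToppleStep G) c d) : Orientable G d := by
  induction hd with
  | refl => exact h
  | tail _ hs ih =>
    obtain ⟨k, hk, rfl⟩ := hs
    exact ih.sendGrains hk subset_rfl

/-! ### Burning -/

theorem card_filter_adj_add_one (hG : ∀ k : Fin n, G.Adj k.succ 0) (k : Fin n) :
    (Finset.univ.filter fun l : Fin n => G.Adj k.succ l.succ).card + 1 = G.degree k.succ := by
  have := card_filter_succ_mem (G.neighborFinset k.succ)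
  rw [if_pos (by simpa using hG k), G.card_neighborFinset_eq_degree] at this
  simpa using this

/-- The edges are oriented by a height function, and every vertex has at least as many grains as
neighbours which are not lower. -/
def Burnable (G : SimpleGraph (Fin (n + 1))) [DecidableRel G.Adj] (c : Config n) : Prop :=
  ∃ h : Fin n → ℤ,
    ∀ k, (Finset.univ.filter fun l => G.Adj k.succ l.succ ∧ h k ≤ h l).card ≤ c k

/-- After the sink has fired, every vertex topples once, in order of increasing height. -/
theorem Burnable.reflTransGen (hG : ∀ k : Fin n, G.Adj k.succ 0) {c : Config n}
    (hc : Burnable G c) : Relation.ReflTransGen (ToppleStep G) (c + 1) c := by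
  obtain ⟨h, hc⟩ := hc
  -- `b T` is `c + 1` after each vertex of `T` has toppled once. By `key`, a vertex whose strictly
  -- lower vertices all lie in `T` has enough grains to topple, so the subtraction does not truncate
  -- on the sets used.
  let b : Finset (Fin n) → Config n := fun T l =>
    c l + 1 + (T.filter fun m => G.Adj l.succ m.succ).card - if l ∈ T then G.degree l.succ else 0
  have key : ∀ (T : Finset (Fin n)) (k : Fin n), (∀ l, h l < h k → l ∈ T) →
      G.degree k.succ ≤ c k + 1 + (T.filter fun m => G.Adj k.succ m.succ).card := by
    intro T k hT
    have hsub : (Finset.univ.filter fun l : Fin n => G.Adj k.succ l.succ) ⊆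
        (Finset.univ.filter fun l => G.Adj k.succ l.succ ∧ h k ≤ h l) ∪
          T.filter fun m => G.Adj k.succ m.succ := by
      intro l hl
      simp only [Finset.mem_filter, Finset.mem_univ, true_and, Finset.mem_union] at hl ⊢
      rcases le_or_gt (h k) (h l) with h' | h'
      · exact .inl ⟨hl, h'⟩
      · exact .inr ⟨hT l h', hl⟩
    have h1 := (Finset.card_le_card hsub).trans (Finset.card_union_le _ _)
    have h2 := card_filter_adj_add_one hG k
    have h3 := hc k
    omega
  have main : ∀ T : Finset (Fin n), (∀ k ∈ T, ∀ l, h l < h k → l ∈ T) →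
      Relation.ReflTransGen (ToppleStep G) (c + 1) (b T) := by
    intro T
    induction hm : T.card generalizing T with
    | zero =>
      intro _
      rw [Finset.card_eq_zero] at hm
      subst hm
      have : b ∅ = c + 1 := by funext l; simp [b]
      rw [this]
    | succ m ih =>
      intro hT
      -- The highest vertex of `T` topples last.
      obtain ⟨k, hkT, hk⟩ := T.exists_max_image h (Finset.card_pos.mp (by omega))
      have hlow : ∀ j ∈ T, ∀ l, h l < h j → l ∈ T.erase k := fun j hj l hl =>
        Finset.mem_erase.mpr ⟨fun hlk => (hk j hj).not_gt (hlk ▸ hl), hT j hj l hl⟩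
      refine (ih (T.erase k) (by rw [Finset.card_erase_of_mem hkT, hm]; rfl)
        fun j hj => hlow j (Finset.mem_of_mem_erase hj)).tail ?_
      have hun : IsUnstableAt G (b (T.erase k)) k := by
        simpa [b] using key (T.erase k) k (hlow k hkT)
      refine ⟨k, hun, ?_⟩
      funext l
      have h1 := topple_apply_add hun l
      have h2 : (T.filter fun m => G.Adj l.succ m.succ).card =
          ((T.erase k).filter fun m => G.Adj l.succ m.succ).card +
            if G.Adj k.succ l.succ then 1 else 0 := by
        conv_lhs => rw [← Finset.insert_erase hkT, Finset.filter_insert]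
        by_cases hlk : G.Adj l.succ k.succ
        · rw [if_pos hlk, if_pos hlk.symm, Finset.card_insert_of_notMem (by simp)]
        · rw [if_neg hlk, if_neg fun h => hlk h.symm, add_zero]
      by_cases hlk : l = k
      · subst hlk
        have h3 := key (T.erase l) l (hlow l hkT)
        simp only [b, if_true, hkT, Finset.notMem_erase, if_false] at h1 ⊢
        omega
      · by_cases hlT : l ∈ T
        · have h3 := key (T.erase k) l (hlow l hlT)
          simp only [b, hlk, hlT, Finset.mem_erase, ne_eq, not_false_eq_true, and_self, if_true,
            if_false] at h1 ⊢
          omega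
        · simp only [b, hlk, hlT, Finset.mem_erase, ne_eq, and_false, if_false] at h1 ⊢
          omega
  have huniv : b Finset.univ = c := by
    funext l
    have := card_filter_adj_add_one hG l
    simp only [b, Finset.mem_univ, if_true]
    omega
  exact huniv ▸ main Finset.univ fun _ _ _ _ => Finset.mem_univ _

theorem Burnable.reflTransGen_add_nsmul (hG : ∀ k : Fin n, G.Adj k.succ 0) {c : Config n}
    (hc : Burnable G c) (N : ℕ) : Relation.ReflTransGen (ToppleStep G) (c + N • 1) c := by
  induction N with
  | zero => simpa using Relation.ReflTransGen.refl
  | succ N ih =>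
    refine Relation.ReflTransGen.trans ?_ ih
    rw [succ_nsmul', ← add_assoc]
    exact reflTransGen_toppleStep_add (hc.reflTransGen hG) _

/-! ### Reachability -/

theorem exists_sum_single (e : Config n) :
    ∃ w : List (Fin n), (w.map fun k => (Pi.single k 1 : Config n)).sum = e := by
  refine ⟨(Finset.univ.toList.flatMap fun k => List.replicate (e k) k), ?_⟩
  rw [List.flatMap_def, List.map_flatten, List.sum_flatten]
  simp only [List.map_map, Function.comp_def, List.map_replicate, List.sum_replicate]
  rw [Finset.sum_map_toList]
  simp only [← Pi.single_smul, nsmul_eq_mul, mul_one]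
  exact Finset.univ_sum_single e

/-- If the relation `R` allows one to add grains one by one and to stabilise after each of them,
then it allows one to add several grains and to stabilise at the end. -/
theorem reflTransGen_of_stabilisesTo (hG : ∀ k : Fin n, G.Adj k.succ 0)
    {R : Config n → Config n → Prop}
    (hR : ∀ d, IsStable G d → ∀ k, Relation.ReflTransGen R d (stabilise G (addGrain d k)))
    (w : List (Fin n)) {d e : Config n} (hd : IsStable G d)
    (h : StabilisesTo G (d + (w.map fun k => (Pi.single k 1 : Config n)).sum) e) :
    Relation.ReflTransGen R d e := by
  induction w generalizing d with
  | nil =>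
    have : e = d := hd.eq_of_reflTransGen (by simpa using h.1)
    exact this ▸ .refl
  | cons k w ih =>
    have hs := stabilisesTo_stabilise hG (addGrain d k)
    -- By confluence, stabilising before the remaining grains arrive does not change the final
    -- result.
    refine (hR d hd k).trans (ih hs.2 (h.of_reflTransGen ?_))
    have := reflTransGen_toppleStep_add hs.1 (w.map fun k => (Pi.single k 1 : Config n)).sum
    rw [List.map_cons, List.sum_cons, ← add_assoc]
    exact this

/-- For large `N`, `c + N • 1` dominates `d` and topples back to `c`; it remains to add the
difference to `d` grain by grain. -/
theorem Burnable.reachable (hG : ∀ k : Fin n, G.Adj k.succ 0)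
    {R : Config n → Config n → Prop}
    (hR : ∀ d, IsStable G d → ∀ k, Relation.ReflTransGen R d (stabilise G (addGrain d k)))
    {c d : Config n} (hc : Burnable G c) (hcs : IsStable G c) (hd : IsStable G d) :
    Relation.ReflTransGen R d c := by
  have hdle : d ≤ c + (∑ l, d l) • 1 := fun l => by
    have := Finset.single_le_sum (fun i _ => Nat.zero_le (d i)) (Finset.mem_univ l)
    simp only [Pi.add_apply, Pi.smul_apply, Pi.one_apply, smul_eq_mul, mul_one]
    omega
  obtain ⟨w, hw⟩ := exists_sum_single (c + (∑ l, d l) • 1 - d)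
  refine reflTransGen_of_stabilisesTo hG hR w hd ⟨?_, hcs⟩
  rw [hw, add_tsub_cancel_of_le hdle]
  exact hc.reflTransGen_add_nsmul hG _

end Toppling

/-! ## Recurrent configurations and orientations -/

section Recurrence

open MeasureTheory Filter

variable {n : ℕ} {G : SimpleGraph (Fin (n + 1))} [DecidableRel G.Adj]

theorem setOf_sum_le_finite (M : ℕ) : {c : Config n | ∑ k, c k ≤ M}.Finite :=
  (Set.finite_Iic (fun _ => M : Config n)).subset fun c (hc : _ ≤ M) k =>
    (Finset.single_le_sum (fun i _ => Nat.zero_le (c i)) (Finset.mem_univ k)).trans hc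

theorem IsStable.sum_add_le {c : Config n} (hc : IsStable G c) :
    ∑ k, c k + n ≤ ∑ k : Fin n, G.degree k.succ := by
  have h := Finset.sum_le_sum fun (k : Fin n) (_ : k ∈ Finset.univ) => Nat.succ_le_of_lt (hc k)
  simpa [Finset.sum_add_distrib] using h

-- The maximal stable configuration has as many grains at each vertex as non-sink neighbours, so
-- even orienting every edge both ways is allowed.
variable (G) in
theorem exists_isStable_orientable (hG : ∀ k : Fin n, G.Adj k.succ 0) :
    ∃ c, IsStable G c ∧ Orientable G c := by
  refine ⟨fun k => G.degree k.succ - 1, fun k => ?_, fun _ _ => true, by simp, fun k => ?_⟩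
  · have := card_filter_adj_add_one hG k
    change G.degree k.succ - 1 < G.degree k.succ
    omega
  · have := card_filter_adj_add_one hG k
    simp only [and_true]
    omega

/-! ### The Abelian sandpile model -/

theorem asmRun_eq_drivenRun (c : Config n) (ω : ℕ → Fin n) (t : ℕ) :
    asmRun G c ω t = drivenRun (fun c k => stabilise G (addGrain c k)) c ω t := by
  induction t with
  | zero => rfl
  | succ t ih => rw [asmRun, drivenRun, ih]

theorem asmRec_eq (hG : ∀ k : Fin n, G.Adj k.succ 0)
    (hburn : ∀ c, IsStable G c → Orientable G c → Burnable G c)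
    (μ : PMF (Fin n)) (hμ : ∀ k, 0 < μ k) :
    ASMRec G μ = {c | IsStable G c ∧ Orientable G c} := by
  let f : Config n → Fin n → Config n := fun c k => stabilise G (addGrain c k)
  have hν : ∀ k, μ.toMeasure {k} ≠ 0 := fun k => by
    rw [μ.toMeasure_apply_singleton k (measurableSet_singleton k)]
    exact (hμ k).ne'
  have hfin : {c | IsStable G c}.Finite :=
    (setOf_sum_le_finite (∑ k : Fin n, G.degree k.succ)).subset fun c (hc : IsStable G c) =>
      (Nat.le_add_right _ _).trans hc.sum_add_le
  have hK : ∀ c ∈ {c | IsStable G c}, ∀ k, f c k ∈ {c | IsStable G c} :=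
    fun c _ k => (stabilisesTo_stabilise hG _).2
  have hreach : ∀ c, IsStable G c → Orientable G c → ∀ d ∈ {c | IsStable G c},
      DrivenReach f d c := fun c hc ho d hd =>
    (hburn c hc ho).reachable hG (fun d _ k => .single ⟨k, rfl⟩) hc hd
  obtain ⟨c₀, hc₀, ho₀⟩ := exists_isStable_orientable G hG
  ext c
  refine ⟨fun ⟨hc, hrec⟩ => ⟨hc, ?_⟩, fun ⟨hc, ho⟩ => ⟨hc, ?_⟩⟩
  · refine mem_of_ae_frequently_visits μ.toMeasure hν hfin hK (hreach c₀ hc₀ ho₀)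
      (A := {c | Orientable G c}) (fun d hd k => ?_) ho₀ hc ?_
    · exact (Orientable.addGrain hd k).of_reflTransGen (stabilisesTo_stabilise hG _).1
    · simpa only [asmRun_eq_drivenRun] using hrec
  · simpa only [asmRun_eq_drivenRun] using
      ae_frequently_visits μ.toMeasure hν hfin hK (hreach c hc ho) hc

/-! ### The stochastic sandpile model -/

theorem ssmRun_eq_drivenRun (c : Config n) (ω : ℕ → Fin n × (Fin (n + 1) → Bool)) (t : ℕ) :
    ssmRun G c ω t = drivenRun (ssmStep G) c ω t := by
  induction t with
  | zero => rfl
  | succ t ih => rw [ssmRun, drivenRun, ih]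

theorem ssmStep_of_isStable {c : Config n} (hc : IsStable G c)
    (x : Fin n × (Fin (n + 1) → Bool)) : ssmStep G c x = addGrain c x.1 := by
  have : Fin.find? (fun k => decide (IsUnstableAt G c k)) = none := by
    rw [Fin.find?_eq_none_iff]
    exact fun k => decide_eq_false (hc k).not_ge
  rw [ssmStep, this]

theorem exists_ssmStep_eq_coinTopple {c : Config n} (hc : ¬ IsStable G c) :
    ∃ k, IsUnstableAt G c k ∧ ∀ x, ssmStep G c x = coinTopple G c k x.2 := by
  cases h : Fin.find? (fun k => decide (IsUnstableAt G c k)) with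
  | none =>
    rw [Fin.find?_eq_none_iff] at h
    exact absurd (fun k => not_le.mp (of_decide_eq_false (h k))) hc
  | some k => exact ⟨k, of_decide_eq_true (Fin.eq_true_of_find?_eq_some h), fun x => by
      rw [ssmStep, h]⟩

theorem coinTopple_true (c : Config n) (k : Fin n) :
    coinTopple G c k (fun _ => true) = topple G c k := by
  simp [coinTopple, topple]

/-- With all coins `true`, the SSM performs ordinary topplings. It always chooses the first unstable
vertex, but confluence makes the order irrelevant. -/
theorem drivenReach_ssmStep_of_stabilisesTo (hG : ∀ k : Fin n, G.Adj k.succ 0) {c d : Config n}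
    (h : StabilisesTo G c d) : DrivenReach (ssmStep G) c d := by
  induction hm : ∑ l, c l using Nat.strong_induction_on generalizing c with
  | _ m ih =>
    by_cases hc : IsStable G c
    · exact hc.eq_of_reflTransGen h.1 ▸ .refl
    · obtain ⟨k, hk, hstep⟩ := exists_ssmStep_eq_coinTopple hc
      refine .head ⟨(k, fun _ => true), rfl⟩ ?_
      rw [hstep, coinTopple_true]
      exact ih _ (hm ▸ sum_topple_lt hG hk) (h.of_reflTransGen (.single ⟨k, hk, rfl⟩)) rfl

theorem ssmNoise_singleton_ne_zero (μ : PMF (Fin n)) (hμ : ∀ k, 0 < μ k) (p : I) (hp0 : 0 < p)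
    (hp1 : p < 1) (x : Fin n × (Fin (n + 1) → Bool)) : ssmNoise μ p {x} ≠ 0 := by
  rw [ssmNoise, ← Set.singleton_prod_singleton (a := x.1) (b := x.2), Measure.prod_prod,
    μ.toMeasure_apply_singleton _ (measurableSet_singleton _), Measure.pi_singleton]
  refine mul_ne_zero (hμ _).ne' (Finset.prod_ne_zero_iff.mpr fun v _ => ?_)
  have h0 : unitInterval.toNNReal p ≠ 0 := fun h => hp0.ne' (Subtype.ext (congrArg NNReal.toReal h))
  have h1 : unitInterval.toNNReal (unitInterval.symm p) ≠ 0 := fun h =>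
    hp1.ne (unitInterval.symm_bijective.1 (Subtype.ext (by
      simpa using congrArg NNReal.toReal h)))
  cases x.2 v
  · rw [ProbabilityTheory.bernoulliMeasure_apply_of_notMem_of_mem] <;> simp [h1]
  · rw [ProbabilityTheory.bernoulliMeasure_apply_of_mem_of_notMem] <;> simp [h0]

theorem ssmRec_eq (hG : ∀ k : Fin n, G.Adj k.succ 0)
    (hburn : ∀ c, IsStable G c → Orientable G c → Burnable G c)
    (μ : PMF (Fin n)) (hμ : ∀ k, 0 < μ k) (p : I) (hp0 : 0 < p) (hp1 : p < 1) :
    SSMRec G μ p = {c | IsStable G c ∧ Orientable G c} := by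
  have hν := ssmNoise_singleton_ne_zero μ hμ p hp0 hp1
  have hn : 0 < n := by
    obtain ⟨k, _⟩ := μ.support_nonempty
    exact k.pos
  -- Unstable intermediate states must be included. A stable state lies at least `n ≥ 1` grains
  -- below the bound, which leaves room for the added grain, and topplings never increase the sum.
  let K : Set (Config n) := {c | ∑ k, c k ≤ ∑ k : Fin n, G.degree k.succ}
  have hstab : ∀ c, IsStable G c → c ∈ K := fun c hc =>
    (Nat.le_add_right _ _).trans hc.sum_add_le
  have hcoin : ∀ (k : Fin n) (b : Fin (n + 1) → Bool),
      {v ∈ G.neighborFinset k.succ | b v = true} ⊆ G.neighborFinset k.succ :=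
    fun k b => Finset.filter_subset _ _
  have hK : ∀ c ∈ K, ∀ x, ssmStep G c x ∈ K := fun c hcK x => by
    by_cases hc : IsStable G c
    · rw [ssmStep_of_isStable hc]
      have := hc.sum_add_le
      simp only [K, Set.mem_ofPred_eq, addGrain, Pi.add_apply, Finset.sum_add_distrib,
        Finset.sum_pi_single', Finset.mem_univ, if_true]
      omega
    · obtain ⟨k, hk, hstep⟩ := exists_ssmStep_eq_coinTopple hc
      rw [hstep]
      refine (sum_sendGrains_le ((Finset.card_le_card (hcoin k x.2)).trans ?_)).trans hcK
      rwa [G.card_neighborFinset_eq_degree]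
  have hreach : ∀ c, IsStable G c → Orientable G c → ∀ d ∈ K, DrivenReach (ssmStep G) d c := by
    intro c hc ho d _
    have hs := stabilisesTo_stabilise hG d
    refine (drivenReach_ssmStep_of_stabilisesTo hG hs).trans
      ((hburn c hc ho).reachable hG (fun d hd k => ?_) hc hs.2)
    refine .head ⟨(k, fun _ => true), rfl⟩ ?_
    rw [ssmStep_of_isStable hd]
    exact drivenReach_ssmStep_of_stabilisesTo hG (stabilisesTo_stabilise hG _)
  obtain ⟨c₀, hc₀, ho₀⟩ := exists_isStable_orientable G hG
  ext c
  refine ⟨fun ⟨hc, hrec⟩ => ⟨hc, ?_⟩, fun ⟨hc, ho⟩ => ⟨hc, ?_⟩⟩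
  · refine mem_of_ae_frequently_visits (ssmNoise μ p) hν (setOf_sum_le_finite _) hK
      (hreach c₀ hc₀ ho₀) (A := {c | Orientable G c}) (fun d hd x => ?_) ho₀ (hstab c hc) ?_
    · by_cases hd' : IsStable G d
      · rw [ssmStep_of_isStable hd']
        exact Orientable.addGrain hd x.1
      · obtain ⟨k, hk, hstep⟩ := exists_ssmStep_eq_coinTopple hd'
        rw [hstep]
        exact Orientable.sendGrains hd hk (hcoin k x.2)
    · simpa only [ssmRun_eq_drivenRun] using hrec
  · simpa only [ssmRun_eq_drivenRun] using
      ae_frequently_visits (ssmNoise μ p) hν (setOf_sum_le_finite _) hK (hreach c hc ho) (hstab c hc)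

end Recurrence

/-! ## Orientations of fan graphs -/

section Fan

variable {n : ℕ}

theorem fanGraph_adj_succ_zero (k : Fin n) : (fanGraph n).Adj k.succ 0 :=
  ⟨Fin.succ_ne_zero k, .inr (.inl rfl)⟩

theorem fanGraph_adj_succ_succ (k l : Fin n) :
    (fanGraph n).Adj k.succ l.succ ↔ l.val = k.val + 1 ∨ l.val + 1 = k.val := by
  simp only [fanGraph, ne_eq, Fin.val_succ, Fin.ext_iff, Fin.val_zero]
  omega

theorem ite_one_zero_le {P Q : Prop} [Decidable P] [Decidable Q] (h : P → Q) :
    (if P then 1 else 0 : ℕ) ≤ if Q then 1 else 0 := by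
  by_cases hP : P
  · simp [hP, h hP]
  · simp [hP]

theorem card_filter_fanGraph_adj (k : Fin n) (Q : Fin n → Prop) [DecidablePred Q] :
    (Finset.univ.filter fun l : Fin n => (fanGraph n).Adj k.succ l.succ ∧ Q l).card =
      (if ∃ h : k.val + 1 < n, Q ⟨k.val + 1, h⟩ then 1 else 0) +
        if ∃ _ : 1 ≤ k.val, Q ⟨k.val - 1, by omega⟩ then 1 else 0 := by
  have hsplit : ∀ l : Fin n, (if (fanGraph n).Adj k.succ l.succ ∧ Q l then 1 else 0) =
      (if l.val = k.val + 1 then if Q l then 1 else 0 else 0) +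
        if l.val + 1 = k.val then if Q l then 1 else 0 else 0 := by
    intro l
    simp only [fanGraph_adj_succ_succ]
    by_cases h1 : l.val = k.val + 1
    · have h2 : ¬ l.val + 1 = k.val := by omega
      simp [h1, show ¬ k.val + 1 + 1 = k.val by omega]
    · by_cases h2 : l.val + 1 = k.val <;> simp [h1, h2]
  rw [Finset.card_filter, Finset.sum_congr rfl fun l _ => hsplit l, Finset.sum_add_distrib]
  congr 1
  · by_cases h : k.val + 1 < n
    · rw [Finset.sum_eq_single ⟨k.val + 1, h⟩]
      · simp [h]
      · intro l _ hl
        rw [if_neg fun h' => hl (Fin.ext h')]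
      · simp
    · rw [Finset.sum_eq_zero fun l _ => if_neg (by omega), if_neg (by simp [h])]
  · by_cases h : 1 ≤ k.val
    · rw [Finset.sum_eq_single ⟨k.val - 1, by omega⟩]
      · simp [h]
      · intro l _ hl
        rw [if_neg fun h' => hl (Fin.ext (by simp only; omega))]
      · simp
    · rw [Finset.sum_eq_zero fun l _ => if_neg (by omega), if_neg (by simp [h])]

theorem fanGraph_degree_succ (k : Fin n) :
    (fanGraph n).degree k.succ =
      1 + (if k.val + 1 < n then 1 else 0) + if 1 ≤ k.val then 1 else 0 := by
  have h := card_filter_fanGraph_adj k fun _ => True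
  rw [← card_filter_adj_add_one fanGraph_adj_succ_zero k]
  simp only [and_true, exists_prop] at h
  rw [h]
  ring

theorem fanGraph_degree_zero : (fanGraph n).degree 0 = n := by
  have h := card_filter_succ_mem ((fanGraph n).neighborFinset 0)
  have h' : ∀ l : Fin n, (fanGraph n).Adj 0 l.succ := fun l => (fanGraph_adj_succ_zero l).symm
  simpa [h'] using h.symm

theorem card_edgeFinset_fanGraph (hn : 1 ≤ n) :
    ((fanGraph n).edgeFinset.card : ℤ) = 2 * n - 1 := by
  obtain ⟨m, rfl⟩ : ∃ m, n = m + 1 := ⟨n - 1, by omega⟩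
  have h := (fanGraph (m + 1)).sum_degrees_eq_twice_card_edges
  rw [Fin.sum_univ_succ, fanGraph_degree_zero] at h
  simp only [fanGraph_degree_succ, Finset.sum_add_distrib] at h
  have h1 : ∑ k : Fin (m + 1), (if k.val + 1 < m + 1 then 1 else 0) = m := by
    rw [Fin.sum_univ_castSucc]
    simp
  have h2 : ∑ k : Fin (m + 1), (if 1 ≤ k.val then 1 else 0) = m := by
    rw [Fin.sum_univ_succ]
    simp
  rw [h1, h2] at h
  simp at h
  push_cast
  omega

/-- The edges `{i, i + 1}` with `1 ≤ i < n` are oriented by `s`, with `s i` meaning `i → i + 1`, and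
every vertex has at least as many grains as incoming path edges. -/
def PathOriented (c : Config n) (s : ℕ → Bool) : Prop :=
  ∀ k : Fin n, (if k.val + 1 < n ∧ s (k.val + 1) = false then 1 else 0) +
    (if 1 ≤ k.val ∧ s k.val = true then 1 else 0) ≤ c k

theorem exists_pathOriented_of_orientable {c : Config n} (h : Orientable (fanGraph n) c) :
    ∃ s, PathOriented c s := by
  obtain ⟨o, ho, hc⟩ := h
  -- The edge `{j, j + 1}` joins the indices `j - 1` and `j`. An edge oriented both ways is read as
  -- pointing right, which only lowers indegrees.
  refine ⟨fun j => decide (∃ h : 1 ≤ j ∧ j < n, o ⟨j - 1, by omega⟩ ⟨j, h.2⟩ = true), fun k => ?_⟩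
  refine le_trans ?_ (hc k)
  rw [card_filter_fanGraph_adj k fun l => o l k = true]
  refine Nat.add_le_add ?_ ?_
  · refine ite_one_zero_le fun ⟨h, h1⟩ => ⟨h, ?_⟩
    have hadj := (fanGraph_adj_succ_succ k ⟨k.val + 1, h⟩).mpr (.inl rfl)
    exact (ho _ _ hadj).resolve_left fun ho =>
      of_decide_eq_false h1 ⟨⟨Nat.le_add_left _ _, h⟩, ho⟩
  · exact ite_one_zero_le fun ⟨h, h1⟩ => ⟨h, (of_decide_eq_true h1).2⟩

theorem PathOriented.orientable {c : Config n} {s : ℕ → Bool} (h : PathOriented c s) :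
    Orientable (fanGraph n) c := by
  refine ⟨fun a b => if a.val < b.val then s b.val else ! s a.val, fun a b hab => ?_, fun k => ?_⟩
  · rw [fanGraph_adj_succ_succ] at hab
    rcases hab with hab | hab
    · simp only [show a.val < b.val by omega, show ¬ b.val < a.val by omega, if_true, if_false]
      cases s b.val <;> simp
    · simp only [show b.val < a.val by omega, show ¬ a.val < b.val by omega, if_true, if_false]
      cases s a.val <;> simp
  · refine le_trans ?_ (h k)
    rw [card_filter_fanGraph_adj k
      fun l => (if l.val < k.val then s k.val else ! s l.val) = true]
    refine Nat.add_le_add ?_ ?_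
    · refine ite_one_zero_le fun ⟨h1, h2⟩ => ⟨h1, ?_⟩
      simpa [show ¬ k.val + 1 < k.val by omega] using h2
    · refine ite_one_zero_le fun ⟨h1, h2⟩ => ⟨h1, ?_⟩
      simpa [show k.val - 1 < k.val by omega] using h2

/-- A path has no cycles, so a height that drops by one along each directed edge is well defined:
incoming edges come exactly from the higher neighbours. -/
theorem PathOriented.burnable {c : Config n} {s : ℕ → Bool} (h : PathOriented c s) :
    Burnable (fanGraph n) c := by
  let f : ℕ → ℤ := fun k => ∑ j ∈ Finset.range k, if s (j + 1) = true then -1 else 1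
  have hf : ∀ k, f (k + 1) = f k + if s (k + 1) = true then -1 else 1 := fun k =>
    Finset.sum_range_succ _ _
  refine ⟨fun k => f k.val, fun k => (h k).trans' ?_⟩
  rw [card_filter_fanGraph_adj k fun l => f k.val ≤ f l.val]
  refine Nat.add_le_add ?_ ?_
  · refine ite_one_zero_le fun ⟨h1, h2⟩ => ⟨h1, ?_⟩
    simp only [hf] at h2
    by_contra h3
    rw [if_pos (by simpa using h3)] at h2
    omega
  · refine ite_one_zero_le fun ⟨h1, h2⟩ => ⟨h1, ?_⟩
    have h3 := hf (k.val - 1)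
    rw [Nat.sub_add_cancel h1] at h3
    by_contra h4
    rw [if_neg h4] at h3
    simp only at h2
    omega

end Fan

/-! ## The left-to-right construction on recurrent configurations -/

section FanWord

variable {n : ℕ}

theorem grains_succ (c : Config n) (k : Fin n) : grains c (k.val + 1) = c k := by
  simp [grains, k.isLt]

/-- The vertices that are entered from the left by the construction are not empty. -/
def LeftFed (c : Config n) : Prop :=
  ∀ i, 1 ≤ i → i ≤ n → goesRight c (i - 1) = true → 1 ≤ grains c i

/-- The sink accounts for one unit of the degree, so stability bounds the grains by the number of
path neighbours. -/
theorem IsStable.grains_le {c : Config n} (hc : IsStable (fanGraph n) c) {i : ℕ} (h1 : 1 ≤ i)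
    (hn : i ≤ n) :
    grains c i ≤ (if i < n then 1 else 0) + if 2 ≤ i then 1 else 0 := by
  have h := hc ⟨i - 1, by omega⟩
  rw [← grains_succ c, fanGraph_degree_succ] at h
  simp only [Nat.sub_add_cancel h1] at h
  split_ifs at * <;> omega

theorem goesRight_zero (c : Config n) : goesRight c 0 = false := rfl

theorem goesRight_succ (c : Config n) (i : ℕ) : goesRight c (i + 1) = true ↔
    (goesRight c i = false ∧ grains c (i + 1) = 0) ∨
      (goesRight c i = true ∧ grains c (i + 1) ≠ 2) := by
  rw [goesRight]
  cases goesRight c i <;> simp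

/-- The construction orients an edge rightwards only if every suitable orientation does. -/
theorem PathOriented.of_goesRight {c : Config n} (hc : IsStable (fanGraph n) c) {s : ℕ → Bool}
    (h : PathOriented c s) {i : ℕ} (hi : i < n) (hr : goesRight c i = true) : s i = true := by
  induction i with
  | zero => simp [goesRight_zero] at hr
  | succ i ih =>
    -- If `s` pointed left here, vertex `i + 1` would be entered from the right, hence be nonempty;
    -- if it is also entered from the left, it would need two grains. Either way the rule would not
    -- have gone right.
    by_contra hs
    have hk := h ⟨i, by omega⟩
    have hle := hc.grains_le (i := i + 1) (by omega) hi.le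
    rw [← grains_succ c] at hk
    simp only [hi, Bool.not_eq_true _ ▸ hs, and_self, if_true] at hk
    rcases (goesRight_succ c i).mp hr with ⟨_, h2⟩ | ⟨h1, h2⟩
    · omega
    · have hi1 : 1 ≤ i := by
        rcases Nat.eq_zero_or_pos i with rfl | h'
        · simp [goesRight_zero] at h1
        · exact h'
      rw [if_pos ⟨hi1, ih (by omega) h1⟩] at hk
      split_ifs at hle <;> omega

theorem PathOriented.leftFed {c : Config n} (hc : IsStable (fanGraph n) c) {s : ℕ → Bool}
    (h : PathOriented c s) : LeftFed c := by
  intro i h1 hn hr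
  have hi : 1 ≤ i - 1 := by
    rcases Nat.eq_zero_or_pos (i - 1) with h' | h'
    · simp [h', goesRight_zero] at hr
    · exact h'
  have hk := h ⟨i - 1, by omega⟩
  rw [← grains_succ c] at hk
  simp only [Nat.sub_add_cancel h1] at hk
  simp only [hi, h.of_goesRight hc (by omega) hr, and_self, if_true] at hk
  omega

/-- The construction lets a vertex be entered from the right only if a grain is left for that edge;
being fed from the left is the one remaining condition. -/
theorem LeftFed.pathOriented {c : Config n} (h : LeftFed c) : PathOriented c (goesRight c) := by
  intro k
  have hk := h (k.val + 1) (by omega) k.isLt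
  have hs := goesRight_succ c k.val
  rw [Nat.add_sub_cancel] at hk
  rw [← grains_succ c]
  cases h1 : goesRight c k.val <;> cases h2 : goesRight c (k.val + 1) <;>
    simp only [h1, h2, true_and, false_and, or_false, false_or, and_true, and_false, if_false,
      Bool.false_eq_true, Bool.true_eq_false, false_iff, forall_const] at hs hk ⊢ <;>
    (try split_ifs) <;> omega

theorem orientable_iff_leftFed {c : Config n} (hc : IsStable (fanGraph n) c) :
    Orientable (fanGraph n) c ↔ LeftFed c :=
  ⟨fun h => let ⟨_, hs⟩ := exists_pathOriented_of_orientable h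
    hs.leftFed hc, fun h => h.pathOriented.orientable⟩

/-- The number of grains is read off from the marked orientation. -/
theorem LeftFed.grains_eq {c : Config n} (h : LeftFed c) (hc : IsStable (fanGraph n) c) {i : ℕ}
    (h1 : 1 ≤ i) (hn : i ≤ n) : grains c i = (if goesRight c (i - 1) = true then 1 else 0) +
      (if i < n ∧ goesRight c i = false then 1 else 0) + if IsMarked c i then 1 else 0 := by
  obtain ⟨j, rfl⟩ : ∃ j, i = j + 1 := ⟨i - 1, by omega⟩
  have hk := h (j + 1) h1 hn
  have hle := hc.grains_le h1 hn
  have hs := goesRight_succ c j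
  have h0 : goesRight c j = true → 1 ≤ j := fun h => by
    rcases Nat.eq_zero_or_pos j with rfl | h'
    · simp [goesRight_zero] at h
    · exact h'
  unfold IsMarked
  rw [Nat.add_sub_cancel] at hk ⊢
  cases h1 : goesRight c j <;> cases h2 : goesRight c (j + 1) <;>
    simp only [h1, h2, true_and, false_and, or_false, false_or, and_true, and_false, if_false,
      if_true, true_iff, Bool.false_eq_true, Bool.true_eq_false, false_iff, forall_const]
      at hs hk h0 ⊢ <;>
    split_ifs at * <;> omega

/-- The degree bound rules this mark out, so nothing is lost by having no letter for vertex `1`. -/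
theorem not_isMarked_one {c : Config n} (hc : IsStable (fanGraph n) c) (hn : 1 ≤ n) :
    ¬ IsMarked c 1 := by
  rintro ⟨_, h⟩
  have := hc.grains_le le_rfl hn
  split_ifs at this <;> omega

theorem fanWord_eq_R_iff (c : Config n) (k : Fin (n - 1)) :
    fanWord c k = Letter.R ↔ goesRight c (k.val + 1) = true := by
  unfold fanWord
  split_ifs <;> simp_all

theorem fanWord_eq_Lm_iff (c : Config n) (k : Fin (n - 1)) :
    fanWord c k = Letter.Lm ↔ IsMarked c (k.val + 2) := by
  have : IsMarked c (k.val + 2) → goesRight c (k.val + 1) = false := fun h => h.1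
  unfold fanWord
  split_ifs with h1 h2
  · exact iff_of_false nofun fun h => by simp [this h] at h1
  · exact iff_of_true rfl h2
  · exact iff_of_false nofun h2

/-- A marked vertex is nonempty and its left edge points left, so the rule cannot direct its right
edge rightwards. -/
theorem fanWord_mem_PMW (c : Config n) : fanWord c ∈ PMW (n - 1) := by
  intro i j hij hi hj
  rw [fanWord_eq_Lm_iff] at hi
  rw [fanWord_eq_R_iff, ← hij, goesRight_succ] at hj
  obtain ⟨h1, h2⟩ := hi
  simp only [show i.val + 2 - 1 = i.val + 1 by omega] at h1
  simp only [show i.val + 1 + 1 = i.val + 2 by omega] at hj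
  simp only [h1, true_and, Bool.false_eq_true, false_and, or_false] at hj
  omega

theorem LeftFed.eq_of_fanWord_eq {c d : Config n} (hc : LeftFed c) (hcs : IsStable (fanGraph n) c)
    (hd : LeftFed d) (hds : IsStable (fanGraph n) d) (h : fanWord c = fanWord d) : c = d := by
  have hr : ∀ i < n, goesRight c i = goesRight d i := by
    intro i hi
    cases i with
    | zero => rfl
    | succ i =>
      rw [Bool.eq_iff_iff, ← fanWord_eq_R_iff c ⟨i, by omega⟩, h, fanWord_eq_R_iff]
  have hm : ∀ i, 1 ≤ i → i ≤ n → (IsMarked c i ↔ IsMarked d i) := by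
    intro i h1 hn
    rcases Nat.lt_or_ge i 2 with h2 | h2
    · obtain rfl : i = 1 := by omega
      exact iff_of_false (not_isMarked_one hcs hn) (not_isMarked_one hds hn)
    · obtain ⟨j, rfl⟩ : ∃ j, i = j + 2 := ⟨i - 2, by omega⟩
      rw [← fanWord_eq_Lm_iff c ⟨j, by omega⟩, h, fanWord_eq_Lm_iff]
  funext k
  have hk : k.val + 1 ≤ n := k.isLt
  rw [← grains_succ c, ← grains_succ d, hc.grains_eq hcs (by omega) hk,
    hd.grains_eq hds (by omega) hk]
  simp only [Nat.add_sub_cancel, hr _ k.isLt, hm _ (Nat.le_add_left _ _) hk]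
  -- At vertex `n` the value `goesRight c n` corresponds to no letter, but the guard `i < n` removes
  -- it from the formula.
  by_cases h' : k.val + 1 < n
  · rw [hr _ h']
  · simp only [h', false_and]

/-- Summing `LeftFed.grains_eq`, each of the `n - 1` edges is incoming at exactly one endpoint, and
the marks remain. -/
theorem LeftFed.level_eq {c : Config n} (h : LeftFed c) (hc : IsStable (fanGraph n) c)
    (hn : 1 ≤ n) : level (fanGraph n) c = markedCount (fanWord c) := by
  have hsum : ∑ k, c k = (n - 1) + markedCount (fanWord c) := by
    obtain ⟨m, rfl⟩ : ∃ m, n = m + 1 := ⟨n - 1, by omega⟩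
    have hk : ∀ k : Fin (m + 1), c k = (if goesRight c k.val = true then 1 else 0) +
        (if k.val + 1 < m + 1 ∧ goesRight c (k.val + 1) = false then 1 else 0) +
          if IsMarked c (k.val + 1) then 1 else 0 := fun k =>
      (grains_succ c k).symm.trans (h.grains_eq hc (Nat.le_add_left _ _) k.isLt)
    have h1 : ∑ k : Fin (m + 1), (if goesRight c k.val = true then 1 else 0) =
        ∑ k : Fin m, if goesRight c (k.val + 1) = true then 1 else 0 := by
      rw [Fin.sum_univ_succ]
      simp [goesRight_zero]
    have h2 : ∑ k : Fin (m + 1),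
        (if k.val + 1 < m + 1 ∧ goesRight c (k.val + 1) = false then 1 else 0) =
          ∑ k : Fin m, if goesRight c (k.val + 1) = false then 1 else 0 := by
      rw [Fin.sum_univ_castSucc]
      simp
    have h3 : ∑ k : Fin (m + 1), (if IsMarked c (k.val + 1) then 1 else 0) =
        markedCount (fanWord c) := by
      rw [Fin.sum_univ_succ, markedCount, Finset.card_filter]
      rw [if_neg (by simpa using not_isMarked_one hc (by omega)), zero_add]
      exact Finset.sum_congr rfl fun k _ => by simp only [fanWord_eq_Lm_iff]; rfl
    rw [Finset.sum_congr rfl fun k _ => hk k, Finset.sum_add_distrib, Finset.sum_add_distrib, h1,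
      h2, h3, ← Finset.sum_add_distrib]
    congr 1
    have h4 : ∀ k : Fin m, ((if goesRight c (k.val + 1) = true then 1 else 0) +
        if goesRight c (k.val + 1) = false then 1 else 0) = 1 := fun k => by
      cases goesRight c (k.val + 1) <;> rfl
    simp [h4]
  rw [level, fanGraph_degree_zero, card_edgeFinset_fanGraph hn, ← Nat.cast_sum, hsum]
  push_cast [Nat.cast_sub hn]
  ring

/-! ### From marked words back to configurations -/

/-- The configuration with a given marked orientation. -/
def configOfMarks (s mk : ℕ → Bool) : Config n := fun k =>
  (if s k.val = true then 1 else 0) +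
    (if k.val + 1 < n ∧ s (k.val + 1) = false then 1 else 0) + if mk (k.val + 1) = true then 1 else 0

theorem grains_configOfMarks (s mk : ℕ → Bool) {i : ℕ} (hi : i < n) :
    grains (configOfMarks s mk : Config n) (i + 1) = (if s i = true then 1 else 0) +
      (if i + 1 < n ∧ s (i + 1) = false then 1 else 0) + if mk (i + 1) = true then 1 else 0 :=
  grains_succ _ ⟨i, hi⟩

/-- `hmk` says that a mark sits on a left-pointing edge, and `hmk'` is the rule that no `Lᵐ`
precedes an `R`. Together they make the number of grains reveal the direction of the next edge, so
the construction recovers `s`. -/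
theorem goesRight_configOfMarks {s mk : ℕ → Bool} (hs0 : s 0 = false)
    (hmk : ∀ i, mk (i + 1) = true → s i = false) (hmk' : ∀ i < n, mk i = true → s i = false)
    {i : ℕ} (hi : i < n) : goesRight (configOfMarks s mk : Config n) i = s i := by
  induction i with
  | zero => rw [hs0, goesRight_zero]
  | succ i ih =>
    rw [Bool.eq_iff_iff, goesRight_succ, ih (by omega), grains_configOfMarks s mk (by omega)]
    have h1 := hmk i
    have h2 := hmk' (i + 1) hi
    cases h3 : s i <;> cases h4 : s (i + 1) <;> cases h5 : mk (i + 1) <;> simp_all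

theorem isMarked_configOfMarks {s mk : ℕ → Bool} (hs0 : s 0 = false)
    (hmk : ∀ i, mk (i + 1) = true → s i = false) (hmk' : ∀ i < n, mk i = true → s i = false)
    {i : ℕ} (hi : i < n) : IsMarked (configOfMarks s mk : Config n) (i + 1) ↔ mk (i + 1) = true := by
  have h1 := hmk i
  have h2 := hmk' (i + 1)
  unfold IsMarked
  rw [Nat.add_sub_cancel, goesRight_configOfMarks hs0 hmk hmk' hi, grains_configOfMarks s mk hi]
  rcases Nat.lt_or_ge (i + 1) n with h | h
  · have h' : i + 1 ≠ n := h.ne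
    cases h3 : s i <;> cases h4 : s (i + 1) <;> cases h5 : mk (i + 1) <;> simp_all
  · have h' : i + 1 = n := by omega
    cases h3 : s i <;> cases h5 : mk (i + 1) <;> simp_all

/-- A mark occurs only where no edge enters from the left, so it takes the place of that edge in the
count; excluding it at vertex `1` covers the vertex without such an edge. -/
theorem isStable_configOfMarks {s mk : ℕ → Bool} (hs0 : s 0 = false) (hmk1 : mk 1 = false)
    (hmk : ∀ i, mk (i + 1) = true → s i = false) :
    IsStable (fanGraph n) (configOfMarks s mk : Config n) := by
  intro k
  rw [fanGraph_degree_succ]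
  have h1 := hmk k.val
  have h0 : ¬ 1 ≤ k.val → s k.val = false ∧ mk (k.val + 1) = false := fun h => by
    obtain h : k.val = 0 := by omega
    rw [h]
    exact ⟨hs0, hmk1⟩
  unfold configOfMarks
  by_cases hk : 1 ≤ k.val
  · cases h3 : s k.val <;> cases h5 : mk (k.val + 1) <;> simp_all <;> split_ifs <;> omega
  · obtain ⟨h2, h3⟩ := h0 hk
    simp only [h2, h3, hk]
    split_ifs <;> simp_all

theorem leftFed_configOfMarks {s mk : ℕ → Bool} (hs0 : s 0 = false)
    (hmk : ∀ i, mk (i + 1) = true → s i = false) (hmk' : ∀ i < n, mk i = true → s i = false) :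
    LeftFed (configOfMarks s mk : Config n) := by
  intro i h1 hi h
  obtain ⟨j, rfl⟩ : ∃ j, i = j + 1 := ⟨i - 1, by omega⟩
  rw [Nat.add_sub_cancel, goesRight_configOfMarks hs0 hmk hmk' hi] at h
  rw [grains_configOfMarks s mk hi, if_pos h]
  omega

theorem exists_fanWord_eq {w : Fin (n - 1) → Letter} (hw : w ∈ PMW (n - 1)) :
    ∃ c : Config n, IsStable (fanGraph n) c ∧ LeftFed c ∧ fanWord c = w := by
  -- The edge `{i, i + 1}` carries letter `i - 1`, while the mark of vertex `i` sits on the edge `{i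
  -- - 1, i}`, which is letter `i - 2`.
  let s : ℕ → Bool := fun i => decide (∃ h : 1 ≤ i ∧ i < n, w ⟨i - 1, by omega⟩ = Letter.R)
  let mk : ℕ → Bool := fun i => decide (∃ h : 2 ≤ i ∧ i ≤ n, w ⟨i - 2, by omega⟩ = Letter.Lm)
  have hs0 : s 0 = false := by simp [s]
  have hmk1 : mk 1 = false := by simp [mk]
  have hmk : ∀ i, mk (i + 1) = true → s i = false := by
    intro i h
    obtain ⟨h1, h2⟩ := of_decide_eq_true h
    refine decide_eq_false fun ⟨h3, h4⟩ => ?_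
    have : w ⟨i + 1 - 2, by omega⟩ = Letter.R := h4
    rw [h2] at this
    exact absurd this (by simp)
  have hmk' : ∀ i < n, mk i = true → s i = false := by
    intro i hi h
    obtain ⟨h1, h2⟩ := of_decide_eq_true h
    exact decide_eq_false fun ⟨h3, h4⟩ =>
      hw ⟨i - 2, by omega⟩ ⟨i - 1, by omega⟩ (by simp only; omega) h2 h4
  refine ⟨configOfMarks s mk, isStable_configOfMarks hs0 hmk1 hmk,
    leftFed_configOfMarks hs0 hmk hmk', funext fun k => ?_⟩
  have hk : k.val + 1 < n := by omega
  have hR : fanWord (configOfMarks s mk : Config n) k = Letter.R ↔ w k = Letter.R := by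
    rw [fanWord_eq_R_iff, goesRight_configOfMarks hs0 hmk hmk' hk]
    simp [s, hk]
  have hL : fanWord (configOfMarks s mk : Config n) k = Letter.Lm ↔ w k = Letter.Lm := by
    rw [fanWord_eq_Lm_iff, isMarked_configOfMarks hs0 hmk hmk' hk]
    simp [mk, show k.val + 1 + 1 ≤ n from hk]
  cases h1 : fanWord (configOfMarks s mk : Config n) k <;> cases h2 : w k <;> simp_all

end FanWord

theorem theorem5p2 (n : ℕ) (hn : 1 ≤ n)
    (μ : PMF (Fin n)) (hμ : ∀ k : Fin n, 0 < μ k)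
    (p : unitInterval) (hp0 : 0 < p) (hp1 : p < 1) :
    -- the two models have the same recurrent configurations on the fan graph
    SSMRec (fanGraph n) μ p = ASMRec (fanGraph n) μ ∧
    -- the construction never meets a case for which it has no rule
    (∀ c ∈ ASMRec (fanGraph n) μ, ∀ i : ℕ, 1 ≤ i → i < n →
      goesRight c (i - 1) = true → grains c i = 1 ∨ grains c i = 2) ∧
    -- the construction is a bijection
    Set.BijOn fanWord (ASMRec (fanGraph n) μ) (PMW (n - 1)) ∧
    -- the level is the number of marked elements
    (∀ c ∈ ASMRec (fanGraph n) μ, level (fanGraph n) c = (markedCount (fanWord c) : ℤ)) := by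
  have hG := fanGraph_adj_succ_zero (n := n)
  have hburn : ∀ c, IsStable (fanGraph n) c → Orientable (fanGraph n) c →
      Burnable (fanGraph n) c := fun c _ ho =>
    let ⟨_, hs⟩ := exists_pathOriented_of_orientable ho
    hs.burnable
  have hrec : ∀ c, c ∈ ASMRec (fanGraph n) μ ↔ IsStable (fanGraph n) c ∧ LeftFed c := fun c => by
    rw [asmRec_eq hG hburn μ hμ]
    exact and_congr_right orientable_iff_leftFed
  refine ⟨by rw [ssmRec_eq hG hburn μ hμ p hp0 hp1, asmRec_eq hG hburn μ hμ],
    fun c hc i h1 hi hr => ?_,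
    ⟨fun c _ => fanWord_mem_PMW c, fun c hc d hd h => ?_, fun w hw => ?_⟩, fun c hc => ?_⟩
  · obtain ⟨hcs, hcf⟩ := (hrec c).mp hc
    have := hcf i h1 hi.le hr
    have := hcs.grains_le h1 hi.le
    split_ifs at this <;> omega
  · obtain ⟨hcs, hcf⟩ := (hrec c).mp hc
    obtain ⟨hds, hdf⟩ := (hrec d).mp hd
    exact hcf.eq_of_fanWord_eq hcs hdf hds h
  · obtain ⟨c, hcs, hcf, rfl⟩ := exists_fanWord_eq hw
    exact ⟨c, (hrec c).mpr ⟨hcs, hcf⟩, rfl⟩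
  · obtain ⟨hcs, hcf⟩ := (hrec c).mp hc
    exact hcf.level_eq hcs hn
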